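/- Let $(M,\omega)$ be a non-empty (open or closed) symplectic manifold of positive dimension $2n$. For $G\in C^\infty_c(M)$ (smooth compactly supported real functions) let $\mathrm{sgrad}\,G$ be the vector field defined by $dG(\cdot)=\omega(\cdot,\mathrm{sgrad}\,G)$, and let $\{F,G\}:=\omega(\mathrm{sgrad}\,G,\mathrm{sgrad}\,F)=dF(\mathrm{sgrad}\,G)$ be the Poisson bracket. Then there exist functions $F,G\in C^\infty_c(M)$ and a sequence $F_N\in C^\infty_c(M)$, $N\in\mathbb{N}$, such that $F_N\to F$ uniformly on $M$ as $N\to\infty$ and $$\liminf_{N\to\infty}\,\max_M\{\{F_N,G\},F_N\}<0.99\cdot\max_M\{\{F,G\},F\},$$ $$\liminf_{N\to\infty}\bigl(-\min_M\{\{F_N,G\},F_N\}\bigr)<-0.99\cdot\min_M\{\{F,G\},F\}.$$ -/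

import Mathlib

open Filter Topology Set
open scoped Manifold ContDiff

noncomputable section

namespace SymplecticFunctionTheory

/-- The model space of a manifold of dimension `2n` without boundary. -/
abbrev Model (n : ℕ) : Type := EuclideanSpace ℝ (Fin (2 * n))

/-- A non-degenerate alternating bilinear form `a` on a finite-dimensional space represents each
linear functional as `a(·, v)` for exactly one vector `v`. -/
theorem existsUnique_of_nondegenerate {E : Type*} [NormedAddCommGroup E] [NormedSpace ℝ E]
    [FiniteDimensional ℝ E] (a : E [⋀^Fin 2]→L[ℝ] ℝ)
    (ha : ∀ v : E, (∀ w : E, a ![w, v] = 0) → v = 0) (l : E →L[ℝ] ℝ) :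
    ∃! v : E, ∀ w : E, l w = a ![w, v] := by
  have upd0 : ∀ x y z : E, Function.update ![x, y] 0 z = ![z, y] := fun x y z => by
    ext i; fin_cases i <;> simp
  have upd1 : ∀ x y z : E, Function.update ![x, y] 1 z = ![x, z] := fun x y z => by
    ext i; fin_cases i <;> simp
  have add0 : ∀ x x' y : E, a ![x + x', y] = a ![x, y] + a ![x', y] := fun x x' y => by
    simpa only [upd0] using a.map_update_add ![x, y] 0 x x'
  have add1 : ∀ x y y' : E, a ![x, y + y'] = a ![x, y] + a ![x, y'] := fun x y y' => by
    simpa only [upd1] using a.map_update_add ![x, y] 1 y y'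
  have smul0 : ∀ (c : ℝ) (x y : E), a ![c • x, y] = c • a ![x, y] := fun c x y => by
    simpa only [upd0] using a.map_update_smul ![x, y] 0 c x
  have smul1 : ∀ (c : ℝ) (x y : E), a ![x, c • y] = c • a ![x, y] := fun c x y => by
    simpa only [upd1] using a.map_update_smul ![x, y] 1 c y
  let T : E →ₗ[ℝ] Module.Dual ℝ E := LinearMap.mk₂ ℝ (fun v w => a ![w, v])
    (fun v v' w => add1 w v v') (fun c v w => smul1 c w v)
    (fun v w w' => add0 w w' v) (fun c v w => smul0 c w v)
  have hT : Function.Injective T := by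
    rw [injective_iff_map_eq_zero]
    exact fun v hv => ha v fun w => LinearMap.congr_fun hv w
  have hS : Function.Surjective T :=
    (LinearMap.injective_iff_surjective_of_finrank_eq_finrank
      (Subspace.dual_finrank_eq (K := ℝ) (V := E)).symm).mp hT
  obtain ⟨v, hv⟩ := hS (l : E →ₗ[ℝ] ℝ)
  refine ⟨v, fun w => (LinearMap.congr_fun hv w).symm, fun v' hv' => hT ?_⟩
  rw [hv]
  ext w
  exact (hv' w).symm

section Forms

variable {n : ℕ} {M : Type*} [TopologicalSpace M] [ChartedSpace (Model n) M]

/-- The expression of a field `Ω` of alternating bilinear forms on the tangent spaces of `M` in the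
preferred chart at `c`, that is its pullback by the inverse of the chart. It is meaningful on the
target of the chart, an open subset of `ℝ^{2n}`. -/
def chartForm (Ω : ∀ x : M, (TangentSpace (𝓡 (2 * n)) x) [⋀^Fin 2]→L[ℝ] ℝ) (c : M) (y : Model n) :
    (Model n) [⋀^Fin 2]→L[ℝ] ℝ :=
  (Ω ((extChartAt (𝓡 (2 * n)) c).symm y)).compContinuousLinearMap
    (mfderiv 𝓘(ℝ, Model n) (𝓡 (2 * n)) (extChartAt (𝓡 (2 * n)) c).symm y)

end Forms

/-- A symplectic form on a manifold `M` of dimension `2n`: a smooth closed non-degenerate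
differential `2`-form. Smoothness and closedness are expressed in the charts. -/
structure SymplecticForm (n : ℕ) (M : Type*) [TopologicalSpace M] [ChartedSpace (Model n) M] where
  /-- The alternating bilinear form on the tangent space at `x`. -/
  form : ∀ x : M, (TangentSpace (𝓡 (2 * n)) x) [⋀^Fin 2]→L[ℝ] ℝ
  smooth : ∀ c : M, ContDiffOn ℝ ∞ (chartForm form c) (extChartAt (𝓡 (2 * n)) c).target
  closed : ∀ c : M, ∀ y ∈ (extChartAt (𝓡 (2 * n)) c).target, extDeriv (chartForm form c) y = 0
  nondegenerate : ∀ (x : M) (v : TangentSpace (𝓡 (2 * n)) x),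
    (∀ w : TangentSpace (𝓡 (2 * n)) x, form x ![w, v] = 0) → v = 0

namespace SymplecticForm

variable {n : ℕ} {M : Type*} [TopologicalSpace M] [ChartedSpace (Model n) M]

/-- Non-degeneracy: each covector at `x` is `Ω(·, v)` for exactly one tangent vector `v`. -/
theorem existsUnique_dual (Ω : SymplecticForm n M) (x : M)
    (l : TangentSpace (𝓡 (2 * n)) x →L[ℝ] ℝ) :
    ∃! v : TangentSpace (𝓡 (2 * n)) x,
      ∀ w : TangentSpace (𝓡 (2 * n)) x, l w = Ω.form x ![w, v] :=
  existsUnique_of_nondegenerate (E := Model n) (Ω.form x) (Ω.nondegenerate x) l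

/-- The Hamiltonian vector field of `G`, defined by `dG(·) = Ω(·, sgrad G)`. -/
def sgrad (Ω : SymplecticForm n M) (G : M → ℝ) (x : M) : TangentSpace (𝓡 (2 * n)) x :=
  (Ω.existsUnique_dual x (mfderiv (𝓡 (2 * n)) 𝓘(ℝ, ℝ) G x)).choose

theorem mfderiv_eq_form_sgrad (Ω : SymplecticForm n M) (G : M → ℝ) (x : M)
    (w : TangentSpace (𝓡 (2 * n)) x) :
    mfderiv (𝓡 (2 * n)) 𝓘(ℝ, ℝ) G x w = Ω.form x ![w, Ω.sgrad G x] :=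
  (Ω.existsUnique_dual x (mfderiv (𝓡 (2 * n)) 𝓘(ℝ, ℝ) G x)).choose_spec.1 w

/-- The Poisson bracket `{F, G} = Ω(sgrad G, sgrad F) = dF(sgrad G)`. -/
def bracket (Ω : SymplecticForm n M) (F G : M → ℝ) (x : M) : ℝ :=
  Ω.form x ![Ω.sgrad G x, Ω.sgrad F x]

theorem bracket_eq_mfderiv (Ω : SymplecticForm n M) (F G : M → ℝ) (x : M) :
    Ω.bracket F G x = mfderiv (𝓡 (2 * n)) 𝓘(ℝ, ℝ) F x (Ω.sgrad G x) :=
  (Ω.mfderiv_eq_form_sgrad F x (Ω.sgrad G x)).symm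

end SymplecticForm

/-- `F ∈ C^∞_c(M)`: the function `F` is smooth and has compact support. -/
structure IsSmoothCompactlySupported (n : ℕ) {M : Type*} [TopologicalSpace M]
    [ChartedSpace (Model n) M] (F : M → ℝ) : Prop where
  smooth : ContMDiff (𝓡 (2 * n)) 𝓘(ℝ, ℝ) ∞ F
  compactSupport : HasCompactSupport F

end SymplecticFunctionTheory

end

/-! Take compactly supported g, F with d = {g,F} not identically zero, and put κ = max d². Let G =
Γ(g) with Γ(u) = u + (1 - cos(k²u))/k³, so that Γ' = 1 + O(1/k) while Γ'' = k cos(k²u). Then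
{{F,G},F} = -k cos(k²g) d² + O(1) as k grows, so its maximum and minus its minimum are about kκ
(`bracket_bracket_add_cos`, `exists_cos_eq_and_bracket_sq_ge`).

The approximants are T(g,F), where T(u,v) = v + O(1/m) oscillates in v with frequency m. They
converge uniformly, but their derivatives do not. With t = mF, S = 1 + cos(t)/2 and q the
`corrector`, the leading term gets multiplied, up to O(1/k), by S² + q'S - qS' = S²(1 + (q/S)'). The
part -qS' survives m → ∞ because T_u is of size k/m and T_vv of size m. The choice of q makes the
factor 5/8 - cos³(t)/16, which is at most 11/16 (`bracket_bracket_comp`, `abs_reduction_factor_le`).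

Since 11/16 < 0.99 · 9/10, fixing k large and then letting m = N + 1 tend to infinity yields both
inequalities. -/

noncomputable section

namespace SymplecticFunctionTheory

variable {n : ℕ} {M : Type*} [TopologicalSpace M] [ChartedSpace (Model n) M]

/-! ### Pointwise calculus of the Poisson bracket -/

/-- In the chart at `x`, the manifold derivative at `x` is the Fréchet derivative. -/
theorem hasFDerivAt_comp_extChartAt_symm {F : M → ℝ} {x : M}
    (hF : MDifferentiableAt (𝓡 (2 * n)) 𝓘(ℝ, ℝ) F x) :
    HasFDerivAt (E := Model n) (F := ℝ) (F ∘ (extChartAt (𝓡 (2 * n)) x).symm)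
      (mfderiv (𝓡 (2 * n)) 𝓘(ℝ, ℝ) F x) (extChartAt (𝓡 (2 * n)) x x) := by
  have h := hF.hasMFDerivAt.2
  rw [ModelWithCorners.range_eq_univ] at h
  exact hasFDerivWithinAt_univ.1 h

namespace SymplecticForm

variable (Ω : SymplecticForm n M)

/-- The bracket with `G` at `x` is the derivative along a curve through `x`. -/
theorem exists_curve_hasDerivAt_bracket (G : M → ℝ) (x : M) :
    ∃ c : ℝ → M, c 0 = x ∧ ∀ F : M → ℝ, MDifferentiableAt (𝓡 (2 * n)) 𝓘(ℝ, ℝ) F x →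
      HasDerivAt (fun s => F (c s)) (Ω.bracket F G x) 0 := by
  let v : Model n := Ω.sgrad G x
  refine ⟨fun s => (extChartAt (𝓡 (2 * n)) x).symm (extChartAt (𝓡 (2 * n)) x x + s • v),
    by simp, fun F hF => ?_⟩
  have h := hasFDerivAt_comp_extChartAt_symm hF
  have hl : HasDerivAt (fun s : ℝ => extChartAt (𝓡 (2 * n)) x x + s • v) v 0 := by
    simpa using ((hasDerivAt_id (0 : ℝ)).smul_const v).const_add (extChartAt (𝓡 (2 * n)) x x)
  have h' : HasFDerivAt (E := Model n) (F := ℝ) (F ∘ (extChartAt (𝓡 (2 * n)) x).symm)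
      (mfderiv (𝓡 (2 * n)) 𝓘(ℝ, ℝ) F x) (extChartAt (𝓡 (2 * n)) x x + (0 : ℝ) • v) := by
    simpa using! h
  rw [bracket_eq_mfderiv]
  exact h'.comp_hasDerivAt (0 : ℝ) hl

theorem bracket_antisymm (F G : M → ℝ) (x : M) : Ω.bracket F G x = -Ω.bracket G F x := by
  have h := (Ω.form x).map_swap ![Ω.sgrad F x, Ω.sgrad G x] (i := 0) (j := 1) (by decide)
  have e : ![Ω.sgrad F x, Ω.sgrad G x] ∘ Equiv.swap (0 : Fin 2) 1
      = ![Ω.sgrad G x, Ω.sgrad F x] := by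
    ext i : 1; fin_cases i <;> simp
  rw [e] at h
  exact h

theorem bracket_self (F : M → ℝ) (x : M) : Ω.bracket F F x = 0 := by
  linarith [Ω.bracket_antisymm F F x]

theorem bracket_eq_zero_of_eventuallyEq_const {F : M → ℝ} {x : M} (G : M → ℝ) {a : ℝ}
    (h : F =ᶠ[𝓝 x] fun _ => a) : Ω.bracket F G x = 0 := by
  rw [bracket_eq_mfderiv, h.mfderiv_eq, mfderiv_const]
  rfl

end SymplecticForm

/-! ### Coordinate expression and smoothness of the bracket -/

/-- The linear map `v ↦ a(·, v)` attached to an alternating bilinear form `a`. -/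
def flat {E : Type*} [NormedAddCommGroup E] [NormedSpace ℝ E] [FiniteDimensional ℝ E]
    (a : E [⋀^Fin 2]→L[ℝ] ℝ) : E →L[ℝ] E →L[ℝ] ℝ :=
  have upd0 : ∀ x y z : E, Function.update ![x, y] 0 z = ![z, y] := fun x y z => by
    ext i; fin_cases i <;> simp
  have upd1 : ∀ x y z : E, Function.update ![x, y] 1 z = ![x, z] := fun x y z => by
    ext i; fin_cases i <;> simp
  LinearMap.toContinuousLinearMap
    { toFun := fun v => LinearMap.toContinuousLinearMap
        { toFun := fun w => a ![w, v]
          map_add' := fun w w' => by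
            simpa only [upd0] using a.map_update_add ![w, v] 0 w w'
          map_smul' := fun c w => by
            simpa only [upd0, smul_eq_mul, RingHom.id_apply] using a.map_update_smul ![w, v] 0 c w }
      map_add' := fun v v' => by
        ext w
        simpa [upd1] using a.map_update_add ![w, v] 1 v v'
      map_smul' := fun c v => by
        ext w
        simpa [upd1] using a.map_update_smul ![w, v] 1 c v }

theorem flat_apply {E : Type*} [NormedAddCommGroup E] [NormedSpace ℝ E] [FiniteDimensional ℝ E]
    (a : E [⋀^Fin 2]→L[ℝ] ℝ) (v w : E) : flat a v w = a ![w, v] := rfl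

theorem isInvertible_flat {E : Type*} [NormedAddCommGroup E] [NormedSpace ℝ E]
    [FiniteDimensional ℝ E] {a : E [⋀^Fin 2]→L[ℝ] ℝ}
    (ha : ∀ v : E, (∀ w : E, a ![w, v] = 0) → v = 0) : (flat a).IsInvertible := by
  refine ⟨ContinuousLinearEquiv.ofBijective (flat a) ?_ ?_, by ext; rfl⟩
  · rw [LinearMap.ker_eq_bot']
    exact fun v hv => ha v fun w => by
      rw [← flat_apply]; exact DFunLike.congr_fun hv w
  · rw [LinearMap.range_eq_top]
    intro l
    obtain ⟨v, hv, -⟩ := existsUnique_of_nondegenerate a ha l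
    exact ⟨v, by ext w; exact (hv w).symm⟩

theorem contDiffOn_flat {D E : Type*} [NormedAddCommGroup D] [NormedSpace ℝ D]
    [NormedAddCommGroup E] [NormedSpace ℝ E] [FiniteDimensional ℝ E] {k : WithTop ℕ∞}
    {a : D → E [⋀^Fin 2]→L[ℝ] ℝ} {s : Set D} (ha : ContDiffOn ℝ k a s) :
    ContDiffOn ℝ k (fun y => flat (a y)) s := by
  refine contDiffOn_clm_apply.2 fun v => contDiffOn_clm_apply.2 fun w => ?_
  exact (ContinuousAlternatingMap.apply ℝ E ℝ ![w, v]).contDiff.comp_contDiffOn ha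

namespace SymplecticForm

variable (Ω : SymplecticForm n M)

theorem chartForm_apply (c : M) (y w v : Model n) :
    chartForm Ω.form c y ![w, v] =
      Ω.form ((extChartAt (𝓡 (2 * n)) c).symm y)
        ![mfderiv 𝓘(ℝ, Model n) (𝓡 (2 * n)) (extChartAt (𝓡 (2 * n)) c).symm y w,
          mfderiv 𝓘(ℝ, Model n) (𝓡 (2 * n)) (extChartAt (𝓡 (2 * n)) c).symm y v] := by
  refine congrArg (Ω.form ((extChartAt (𝓡 (2 * n)) c).symm y)) ?_
  funext i
  fin_cases i <;> rfl

variable [IsManifold (𝓡 (2 * n)) ∞ M]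

theorem exists_equiv_mfderiv_extChartAt_symm {c : M} {y : Model n}
    (hy : y ∈ (extChartAt (𝓡 (2 * n)) c).target) :
    ∃ e : Model n ≃L[ℝ] Model n, ∀ v : Model n,
      mfderiv 𝓘(ℝ, Model n) (𝓡 (2 * n)) (extChartAt (𝓡 (2 * n)) c).symm y v = e v := by
  have : IsManifold (𝓡 (2 * n)) 1 M := IsManifold.of_le (n := ∞) (by simp)
  have h := isInvertible_mfderivWithin_extChartAt_symm (I := 𝓡 (2 * n)) hy
  rw [ModelWithCorners.range_eq_univ, mfderivWithin_univ] at h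
  obtain ⟨e, he⟩ := h
  exact ⟨e, fun v => by rw [← he]; rfl⟩

theorem mdifferentiableAt_extChartAt_symm {c : M} {y : Model n}
    (hy : y ∈ (extChartAt (𝓡 (2 * n)) c).target) :
    MDifferentiableAt 𝓘(ℝ, Model n) (𝓡 (2 * n)) (extChartAt (𝓡 (2 * n)) c).symm y := by
  have : IsManifold (𝓡 (2 * n)) 1 M := IsManifold.of_le (n := ∞) (by simp)
  have h := mdifferentiableWithinAt_extChartAt_symm (I := 𝓡 (2 * n)) hy
  rwa [ModelWithCorners.range_eq_univ, mdifferentiableWithinAt_univ] at h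

theorem chartForm_nondegenerate {c : M} {y : Model n}
    (hy : y ∈ (extChartAt (𝓡 (2 * n)) c).target) (v : Model n)
    (hv : ∀ w : Model n, chartForm Ω.form c y ![w, v] = 0) : v = 0 := by
  obtain ⟨e, he⟩ := exists_equiv_mfderiv_extChartAt_symm hy
  have h0 : e v = 0 := by
    refine Ω.nondegenerate ((extChartAt (𝓡 (2 * n)) c).symm y) (e v) fun w => ?_
    have h := hv (e.symm w)
    rw [chartForm_apply, he, he] at h
    have hw : e (e.symm w) = w := e.apply_symm_apply w
    rwa [hw] at h
  exact e.injective (h0.trans (map_zero e).symm)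

/-- In a chart, sgrad G is the inverse of `flat` applied to the differential of G. All ingredients
of this expression vary smoothly, which is how `contMDiff_bracket` is obtained. -/
theorem bracket_extChartAt_symm {F G : M → ℝ} {c : M} {y : Model n}
    (hy : y ∈ (extChartAt (𝓡 (2 * n)) c).target)
    (hF : MDifferentiableAt (𝓡 (2 * n)) 𝓘(ℝ, ℝ) F ((extChartAt (𝓡 (2 * n)) c).symm y))
    (hG : MDifferentiableAt (𝓡 (2 * n)) 𝓘(ℝ, ℝ) G ((extChartAt (𝓡 (2 * n)) c).symm y)) :
    Ω.bracket F G ((extChartAt (𝓡 (2 * n)) c).symm y) =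
      fderiv ℝ (F ∘ (extChartAt (𝓡 (2 * n)) c).symm) y
        ((flat (chartForm Ω.form c y)).inverse
          (fderiv ℝ (G ∘ (extChartAt (𝓡 (2 * n)) c).symm) y)) := by
  obtain ⟨e, he⟩ := exists_equiv_mfderiv_extChartAt_symm hy
  have hd : ∀ H : M → ℝ,
      MDifferentiableAt (𝓡 (2 * n)) 𝓘(ℝ, ℝ) H ((extChartAt (𝓡 (2 * n)) c).symm y) →
      ∀ w : Model n, fderiv ℝ (H ∘ (extChartAt (𝓡 (2 * n)) c).symm) y w =
        mfderiv (𝓡 (2 * n)) 𝓘(ℝ, ℝ) H ((extChartAt (𝓡 (2 * n)) c).symm y) (e w) := by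
    intro H hH w
    rw [← mfderiv_eq_fderiv, mfderiv_comp y hH (mdifferentiableAt_extChartAt_symm hy), ← he]
    rfl
  obtain ⟨v, hv⟩ : ∃ v : Model n, v = Ω.sgrad G ((extChartAt (𝓡 (2 * n)) c).symm y) := ⟨_, rfl⟩
  have hu : flat (chartForm Ω.form c y) (e.symm v) =
      fderiv ℝ (G ∘ (extChartAt (𝓡 (2 * n)) c).symm) y := by
    ext w
    have h1 := hd G hG w
    have h2 := Ω.mfderiv_eq_form_sgrad G ((extChartAt (𝓡 (2 * n)) c).symm y) (e w)
    have h3 := Ω.chartForm_apply c y w (e.symm v)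
    rw [he, he, e.apply_symm_apply] at h3
    rw [← hv] at h2
    exact h3.trans (h2.symm.trans h1.symm)
  obtain ⟨L, hL⟩ := isInvertible_flat (Ω.chartForm_nondegenerate hy)
  rw [← hu, ← hL, ContinuousLinearMap.inverse_equiv, bracket_eq_mfderiv, ← hv]
  erw [L.symm_apply_apply, hd F hF, e.apply_symm_apply]

theorem contMDiff_bracket {F G : M → ℝ} (hF : ContMDiff (𝓡 (2 * n)) 𝓘(ℝ, ℝ) ∞ F)
    (hG : ContMDiff (𝓡 (2 * n)) 𝓘(ℝ, ℝ) ∞ G) :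
    ContMDiff (𝓡 (2 * n)) 𝓘(ℝ, ℝ) ∞ (Ω.bracket F G) := by
  intro c
  have hf : ∀ H : M → ℝ, ContMDiff (𝓡 (2 * n)) 𝓘(ℝ, ℝ) ∞ H →
      ContDiffOn ℝ ∞ (fderiv ℝ (H ∘ (extChartAt (𝓡 (2 * n)) c).symm))
        (extChartAt (𝓡 (2 * n)) c).target := fun H hH => by
    have h := hH.comp_contMDiffOn (contMDiffOn_extChartAt_symm (I := 𝓡 (2 * n)) (n := ∞) c)
    rw [contMDiffOn_iff_contDiffOn] at h
    exact h.fderiv_of_isOpen (isOpen_extChartAt_target c) (by simp)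
  have hinv : ContDiffOn ℝ ∞ (fun y => (flat (chartForm Ω.form c y)).inverse)
      (extChartAt (𝓡 (2 * n)) c).target := fun y hy => by
    have h := (isInvertible_flat (Ω.chartForm_nondegenerate hy)).contDiffAt_map_inverse (n := ∞)
    exact ContDiffAt.comp_contDiffWithinAt y h (contDiffOn_flat (Ω.smooth c) y hy)
  have hB := (hf F hF).clm_apply (hinv.clm_apply (hf G hG))
  have hBc := (hB.contDiffAt ((isOpen_extChartAt_target c).mem_nhds
    (mem_extChartAt_target c))).contMDiffAt.comp c (contMDiffAt_extChartAt (n := ∞) (x := c))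
  refine hBc.congr_of_eventuallyEq ?_
  filter_upwards [extChartAt_source_mem_nhds (I := 𝓡 (2 * n)) c] with x hx
  have h := Ω.bracket_extChartAt_symm ((extChartAt (𝓡 (2 * n)) c).map_source hx)
    ((hF _).mdifferentiableAt (by simp)) ((hG _).mdifferentiableAt (by simp))
  rwa [(extChartAt (𝓡 (2 * n)) c).left_inv hx] at h

end SymplecticForm

/-! ### Functions with a non-zero bracket -/

/-- Every covector at the base point of a chart is the differential of some `F ∈ C^∞_c(M)`. -/
theorem exists_isSmoothCompactlySupported_fderiv_eq [T2Space M] [IsManifold (𝓡 (2 * n)) ∞ M]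
    (p : M) (l : Model n →L[ℝ] ℝ) :
    ∃ F : M → ℝ, IsSmoothCompactlySupported n F ∧
      fderiv ℝ (F ∘ (extChartAt (𝓡 (2 * n)) p).symm) (extChartAt (𝓡 (2 * n)) p p) = l := by
  let f : SmoothBumpFunction (𝓡 (2 * n)) p := Classical.choice inferInstance
  refine ⟨fun x => f x • l (extChartAt (𝓡 (2 * n)) p x), ⟨f.contMDiff_smul ?_, ?_⟩, ?_⟩
  · exact l.contDiff.contMDiff.comp_contMDiffOn contMDiffOn_extChartAt
  · exact f.hasCompactSupport.smul_right
  · have h : ((fun x => f x • l (extChartAt (𝓡 (2 * n)) p x)) ∘ (extChartAt (𝓡 (2 * n)) p).symm)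
        =ᶠ[𝓝 (extChartAt (𝓡 (2 * n)) p p)] l := by
      have hc := (continuousAt_extChartAt_symm (I := 𝓡 (2 * n)) p).tendsto
      rw [extChartAt_to_inv] at hc
      filter_upwards [hc.eventually f.eventuallyEq_one,
        (isOpen_extChartAt_target p).mem_nhds (mem_extChartAt_target p)] with y h1 h2
      have h3 := (extChartAt (𝓡 (2 * n)) p).right_inv h2
      simp only [Function.comp_apply, h1, h3]
      simp
    rw [h.fderiv_eq, l.fderiv]

namespace SymplecticForm

variable (Ω : SymplecticForm n M)

theorem exists_bracket_ne_zero [T2Space M] [IsManifold (𝓡 (2 * n)) ∞ M] (hn : 1 ≤ n) (p : M) :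
    ∃ F G : M → ℝ, IsSmoothCompactlySupported n F ∧ IsSmoothCompactlySupported n G ∧
      Ω.bracket F G p ≠ 0 := by
  obtain ⟨v, hv⟩ : ∃ v : Model n, v ≠ 0 := by
    have : Nontrivial (Model n) := by
      have : Nonempty (Fin (2 * n)) := ⟨⟨0, by omega⟩⟩
      infer_instance
    exact exists_ne 0
  have hy := mem_extChartAt_target (I := 𝓡 (2 * n)) p
  -- With dF = ⟨v, ·⟩ and dG = `flat` v at p, the Hamiltonian vector of G is v and the bracket is
  -- ‖v‖².
  obtain ⟨F, hF, hF'⟩ := exists_isSmoothCompactlySupported_fderiv_eq p (innerSL ℝ v)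
  obtain ⟨G, hG, hG'⟩ := exists_isSmoothCompactlySupported_fderiv_eq p
    (flat (chartForm Ω.form p (extChartAt (𝓡 (2 * n)) p p)) v)
  refine ⟨F, G, hF, hG, ?_⟩
  have h := Ω.bracket_extChartAt_symm hy ((hF.smooth _).mdifferentiableAt (by simp))
    ((hG.smooth _).mdifferentiableAt (by simp))
  obtain ⟨L, hL⟩ := isInvertible_flat (Ω.chartForm_nondegenerate hy)
  rw [hF', hG', ← hL, ContinuousLinearMap.inverse_equiv, extChartAt_to_inv] at h
  erw [L.symm_apply_apply] at h
  rw [h, innerSL_apply_apply, real_inner_self_eq_norm_sq]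
  positivity

/-- The double bracket of functions `T(g, F)` and `Γ(g)` in terms of brackets of `g` and `F`. -/
theorem bracket_bracket_comp [IsManifold (𝓡 (2 * n)) ∞ M] {F g : M → ℝ}
    (hF : ContMDiff (𝓡 (2 * n)) 𝓘(ℝ, ℝ) ∞ F) (hg : ContMDiff (𝓡 (2 * n)) 𝓘(ℝ, ℝ) ∞ g)
    {Γ Γ₁ Γ₂ : ℝ → ℝ} {T Tu Tv Tvu Tvv : ℝ → ℝ → ℝ}
    (hΓ : ∀ u, HasDerivAt Γ (Γ₁ u) u) (hΓ₁ : ∀ u, HasDerivAt Γ₁ (Γ₂ u) u)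
    (hT : ∀ (a b : ℝ → ℝ) (a' b' s : ℝ), HasDerivAt a a' s → HasDerivAt b b' s →
      HasDerivAt (fun s => T (a s) (b s)) (Tu (a s) (b s) * a' + Tv (a s) (b s) * b') s)
    (hTv : ∀ (a b : ℝ → ℝ) (a' b' s : ℝ), HasDerivAt a a' s → HasDerivAt b b' s →
      HasDerivAt (fun s => Tv (a s) (b s)) (Tvu (a s) (b s) * a' + Tvv (a s) (b s) * b') s)
    (hΓs : ContMDiff (𝓡 (2 * n)) 𝓘(ℝ, ℝ) ∞ fun x => Γ (g x))
    (hTs : ContMDiff (𝓡 (2 * n)) 𝓘(ℝ, ℝ) ∞ fun x => T (g x) (F x)) (x : M) :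
    Ω.bracket (Ω.bracket (fun x => T (g x) (F x)) fun x => Γ (g x)) (fun x => T (g x) (F x)) x =
      -(Ω.bracket g F x) ^ 2 * (Tvu (g x) (F x) * Γ₁ (g x) * Tv (g x) (F x)
          + Γ₂ (g x) * Tv (g x) (F x) ^ 2 - Tvv (g x) (F x) * Γ₁ (g x) * Tu (g x) (F x))
        - Tv (g x) (F x) * Γ₁ (g x) * (Tu (g x) (F x) * Ω.bracket (Ω.bracket g F) g x
          + Tv (g x) (F x) * Ω.bracket (Ω.bracket g F) F x) := by
  have md : ∀ {H : M → ℝ}, ContMDiff (𝓡 (2 * n)) 𝓘(ℝ, ℝ) ∞ H → ∀ x,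
      MDifferentiableAt (𝓡 (2 * n)) 𝓘(ℝ, ℝ) H x :=
    fun h x => (h x).mdifferentiableAt (by simp)
  have bΓ : ∀ (H : M → ℝ) (x : M),
      Ω.bracket (fun x => Γ (g x)) H x = Γ₁ (g x) * Ω.bracket g H x := by
    intro H x
    obtain ⟨c, hc, hd⟩ := Ω.exists_curve_hasDerivAt_bracket H x
    have h := (hΓ (g (c 0))).comp (0 : ℝ) (hd g (md hg x))
    rw [hc] at h
    exact (hd _ (md hΓs x)).unique h
  have bT : ∀ (H : M → ℝ) (x : M), Ω.bracket (fun x => T (g x) (F x)) H x =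
      Tu (g x) (F x) * Ω.bracket g H x + Tv (g x) (F x) * Ω.bracket F H x := by
    intro H x
    obtain ⟨c, hc, hd⟩ := Ω.exists_curve_hasDerivAt_bracket H x
    have h := hT _ _ _ _ _ (hd g (md hg x)) (hd F (md hF x))
    rw [hc] at h
    exact (hd _ (md hTs x)).unique h
  -- Only the F-derivative of T contributes, because {g, Γ(g)} = 0.
  have hTG : (Ω.bracket (fun x => T (g x) (F x)) fun x => Γ (g x)) =
      fun x => -(Tv (g x) (F x) * (Γ₁ (g x) * Ω.bracket g F x)) := by
    funext x
    rw [bT, Ω.bracket_antisymm g, Ω.bracket_antisymm F, bΓ, bΓ, bracket_self]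
    ring
  have hs := Ω.contMDiff_bracket hTs hΓs
  have hdm := Ω.contMDiff_bracket hg hF
  obtain ⟨c, hc, hd⟩ := Ω.exists_curve_hasDerivAt_bracket (fun x => T (g x) (F x)) x
  have h1 := hd _ (md hs x)
  rw [hTG] at h1
  have h2 := ((hTv _ _ _ _ _ (hd g (md hg x)) (hd F (md hF x))).mul
    (((hΓ₁ (g (c 0))).comp (0 : ℝ) (hd g (md hg x))).mul (hd _ (md hdm x)))).neg
  have h3 := h1.unique h2
  rw [hTG, h3]
  simp only [hc, Function.comp_apply, Pi.mul_apply]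
  rw [Ω.bracket_antisymm g, Ω.bracket_antisymm F, Ω.bracket_antisymm (Ω.bracket g F), bT, bT, bT,
    bracket_self, bracket_self, Ω.bracket_antisymm F g, Ω.bracket_antisymm F (Ω.bracket g F),
    Ω.bracket_antisymm g (Ω.bracket g F)]
  ring

end SymplecticForm

/-! ### Compact supports and extrema -/

theorem IsSmoothCompactlySupported.bracket [IsManifold (𝓡 (2 * n)) ∞ M] (Ω : SymplecticForm n M)
    {F G : M → ℝ} (hF : IsSmoothCompactlySupported n F) (hG : IsSmoothCompactlySupported n G) :
    IsSmoothCompactlySupported n (Ω.bracket F G) := by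
  refine ⟨Ω.contMDiff_bracket hF.smooth hG.smooth, hF.compactSupport.mono' fun x hx => ?_⟩
  by_contra h
  refine hx (Ω.bracket_eq_zero_of_eventuallyEq_const (a := 0) G ?_)
  exact notMem_tsupport_iff_eventuallyEq.1 h

theorem IsSmoothCompactlySupported.exists_isGreatest [Nonempty M] {F : M → ℝ}
    (hF : IsSmoothCompactlySupported n F) : ∃ a, IsGreatest (range F) a := by
  obtain ⟨x, hx⟩ := hF.smooth.continuous.exists_forall_ge_of_hasCompactSupport hF.compactSupport
  exact ⟨F x, mem_range_self x, by rintro _ ⟨y, rfl⟩; exact hx y⟩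

theorem IsSmoothCompactlySupported.exists_isLeast [Nonempty M] {F : M → ℝ}
    (hF : IsSmoothCompactlySupported n F) : ∃ a, IsLeast (range F) a := by
  obtain ⟨x, hx⟩ := hF.smooth.continuous.exists_forall_le_of_hasCompactSupport hF.compactSupport
  exact ⟨F x, mem_range_self x, by rintro _ ⟨y, rfl⟩; exact hx y⟩

/-! ### The oscillating profiles and the reduction factor -/

/-- The derivative of `u ↦ u + (1 - cos (k² u)) / k³` is `1 + oscSlope k u`. -/
def oscSlope (k u : ℝ) : ℝ := Real.sin (k ^ 2 * u) / k

/-- A periodic corrector of the oscillation `sin`. -/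
def corrector (t : ℝ) : ℝ := -Real.sin t - Real.sin (2 * t) / 16

/-- The oscillating perturbation of the projection `(u, v) ↦ v`. -/
def oscillation (k m u v : ℝ) : ℝ :=
  v + (Real.sin (m * v) / 2 + oscSlope k u * corrector (m * v)) / m

theorem hasDerivAt_oscSlope {k : ℝ} (hk : k ≠ 0) (u : ℝ) :
    HasDerivAt (oscSlope k) (k * Real.cos (k ^ 2 * u)) u := by
  have h := (((hasDerivAt_id u).const_mul (k ^ 2)).sin).div_const k
  refine h.congr_deriv ?_
  simp only [id]
  field_simp

theorem hasDerivAt_sub_cos {k : ℝ} (hk : k ≠ 0) (u : ℝ) :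
    HasDerivAt (fun u => u + (1 - Real.cos (k ^ 2 * u)) / k ^ 3) (1 + oscSlope k u) u := by
  have h := (hasDerivAt_id u).add
    (((((hasDerivAt_id u).const_mul (k ^ 2)).cos).const_sub 1).div_const (k ^ 3))
  refine h.congr_deriv ?_
  simp only [id, oscSlope]
  field_simp

theorem hasDerivAt_corrector (t : ℝ) :
    HasDerivAt corrector (-Real.cos t - Real.cos (2 * t) / 8) t := by
  have h := (Real.hasDerivAt_sin t).neg.sub
    ((((hasDerivAt_id t).const_mul 2).sin).div_const 16)
  refine h.congr_deriv ?_
  simp only [id]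
  ring

theorem hasDerivAt_corrector_deriv (t : ℝ) :
    HasDerivAt (fun t => -Real.cos t - Real.cos (2 * t) / 8)
      (Real.sin t + Real.sin (2 * t) / 4) t := by
  have h := (Real.hasDerivAt_cos t).neg.sub
    ((((hasDerivAt_id t).const_mul 2).cos).div_const 8)
  refine h.congr_deriv ?_
  simp only [id]
  ring

theorem abs_corrector_le (t : ℝ) : |corrector t| ≤ 2 := by
  have h1 := Real.neg_one_le_sin t
  have h2 := Real.sin_le_one t
  have h3 := Real.neg_one_le_sin (2 * t)
  have h4 := Real.sin_le_one (2 * t)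
  rw [corrector, abs_le]
  constructor <;> linarith

theorem abs_oscSlope_le {k : ℝ} (hk : 0 < k) (u : ℝ) : |oscSlope k u| ≤ 1 / k := by
  rw [oscSlope, abs_div, abs_of_pos hk]
  gcongr
  exact Real.abs_sin_le_one _

theorem contDiff_corrector : ContDiff ℝ ∞ corrector := by
  unfold corrector; fun_prop

theorem contDiff_oscSlope (k : ℝ) : ContDiff ℝ ∞ (oscSlope k) := by
  unfold oscSlope; fun_prop

theorem abs_oscillation_sub_le {k m : ℝ} (hk : 1 ≤ k) (hm : 0 < m) (u v : ℝ) :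
    |oscillation k m u v - v| ≤ 3 / m := by
  have h1 : |oscSlope k u| ≤ 1 :=
    (abs_oscSlope_le (by linarith) u).trans ((div_le_one (by linarith)).2 hk)
  have h2 : |oscSlope k u * corrector (m * v)| ≤ 1 * 2 := by
    rw [abs_mul]
    exact mul_le_mul h1 (abs_corrector_le _) (abs_nonneg _) zero_le_one
  have h3 := Real.abs_sin_le_one (m * v)
  rw [oscillation, add_sub_cancel_left, abs_div, abs_of_pos hm]
  gcongr
  rw [abs_le] at *
  constructor <;> linarith

/-- Stated along pairs of curves, the form in which `bracket_bracket_comp` takes the chain rule; the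
coefficients of a' and b' are the partial derivatives. -/
theorem hasDerivAt_oscillation {k m : ℝ} (hk : k ≠ 0) (hm : m ≠ 0) (a b : ℝ → ℝ) (a' b' s : ℝ)
    (ha : HasDerivAt a a' s) (hb : HasDerivAt b b' s) :
    HasDerivAt (fun s => oscillation k m (a s) (b s))
      (k * Real.cos (k ^ 2 * a s) * corrector (m * b s) / m * a' +
        (1 + Real.cos (m * b s) / 2 + oscSlope k (a s) *
          (-Real.cos (m * b s) - Real.cos (2 * (m * b s)) / 8)) * b') s := by
  have h1 := hb.const_mul m
  have h2 := ((hasDerivAt_oscSlope hk (a s)).comp s ha).mul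
    ((hasDerivAt_corrector (m * b s)).comp s h1)
  have h := hb.add (((h1.sin.div_const 2).add h2).div_const m)
  refine h.congr_deriv ?_
  simp only [Function.comp_apply]
  field_simp
  ring

theorem hasDerivAt_oscillation_deriv {k : ℝ} (hk : k ≠ 0) (m : ℝ) (a b : ℝ → ℝ) (a' b' s : ℝ)
    (ha : HasDerivAt a a' s) (hb : HasDerivAt b b' s) :
    HasDerivAt (fun s => 1 + Real.cos (m * b s) / 2 + oscSlope k (a s) *
          (-Real.cos (m * b s) - Real.cos (2 * (m * b s)) / 8))
      (k * Real.cos (k ^ 2 * a s) * (-Real.cos (m * b s) - Real.cos (2 * (m * b s)) / 8) * a' +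
        m * (-Real.sin (m * b s) / 2 + oscSlope k (a s) *
          (Real.sin (m * b s) + Real.sin (2 * (m * b s)) / 4)) * b') s := by
  have h1 := hb.const_mul m
  have h2 := ((hasDerivAt_oscSlope hk (a s)).comp s ha).mul
    ((hasDerivAt_corrector_deriv (m * b s)).comp s h1)
  have h := ((h1.cos.div_const 2).const_add 1).add h2
  refine h.congr_deriv ?_
  simp only [Function.comp_apply]
  ring

/-- The reduction factor: at zero slope it equals `5/8 - cos³/16`. -/
theorem abs_reduction_factor_le {b k : ℝ} (hk : 1 ≤ k) (hb : |b| ≤ 1 / k) (t : ℝ) :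
    |(-Real.cos t - Real.cos (2 * t) / 8) * (1 + b) *
        (1 + Real.cos t / 2 + b * (-Real.cos t - Real.cos (2 * t) / 8))
      + (1 + Real.cos t / 2 + b * (-Real.cos t - Real.cos (2 * t) / 8)) ^ 2
      - (-Real.sin t / 2 + b * (Real.sin t + Real.sin (2 * t) / 4)) * (1 + b) * corrector t|
      ≤ 11 / 16 + 30 / k := by
  have hb1 : |b| ≤ 1 := hb.trans ((div_le_one (by linarith)).2 hk)
  have hc := Real.abs_cos_le_one t
  have hs := Real.abs_sin_le_one t
  have hc2 := Real.abs_cos_le_one (2 * t)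
  have hs2 := Real.abs_sin_le_one (2 * t)
  -- With q = -sin t alone the left side would be 5/8 + cos(2t)/8, which reaches 3/4. The harmonic
  -- -sin(2t)/16 trades cos(2t)/8 for -cos³(t)/16.
  have key : (-Real.cos t - Real.cos (2 * t) / 8) * (1 + Real.cos t / 2)
      + Real.sin t / 2 * corrector t + (1 + Real.cos t / 2) ^ 2
      = 5 / 8 - Real.cos t ^ 3 / 16 := by
    rw [corrector, Real.cos_two_mul, Real.sin_two_mul]
    linear_combination (-1 / 2 - Real.cos t / 16) * Real.sin_sq_add_cos_sq t
  have hc3 : |Real.cos t ^ 3| ≤ 1 := by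
    rw [abs_pow]; exact pow_le_one₀ (abs_nonneg _) hc
  have hq := abs_corrector_le t
  generalize corrector t = q at *
  have hp : |-Real.cos t - Real.cos (2 * t) / 8| ≤ 2 := by
    rw [abs_le] at *; constructor <;> linarith
  have hr : |Real.sin t + Real.sin (2 * t) / 4| ≤ 2 := by
    rw [abs_le] at *; constructor <;> linarith
  have hS : |1 + Real.cos t / 2| ≤ 3 / 2 := by
    rw [abs_le] at *; constructor <;> linarith
  generalize -Real.cos t - Real.cos (2 * t) / 8 = p at *
  generalize Real.sin t + Real.sin (2 * t) / 4 = r at *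
  generalize 1 + Real.cos t / 2 = S at *
  have mb : ∀ {x y X Y : ℝ}, |x| ≤ X → |y| ≤ Y → |x * y| ≤ X * Y := fun hx hy => by
    rw [abs_mul]; exact mul_le_mul hx hy (abs_nonneg _) ((abs_nonneg _).trans hx)
  have e1 := mb hp hp
  have e2 := mb hr hq
  have e3 := mb hp hS
  have e4 := mb hs hq
  have e5 := mb hb1 e1
  have e6 := mb hb1 e2
  -- This is the cofactor of b in the deviation from b = 0; its terms are bounded by 4 + 4 + 3 + 1 +
  -- 4 + 4 + 6 + 4 = 30.
  have hrest : |p * p - r * q + p * S + Real.sin t * q / 2 + (b * (p * p) - b * (r * q))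
      + 2 * (p * S) + b * (p * p)| ≤ 30 := by
    rw [abs_le] at *; constructor <;> linarith
  have hfin := mb hb hrest
  have hE : p * (1 + b) * (S + b * p) + (S + b * p) ^ 2
      - (-Real.sin t / 2 + b * r) * (1 + b) * q = (5 / 8 - Real.cos t ^ 3 / 16)
      + b * (p * p - r * q + p * S + Real.sin t * q / 2 + (b * (p * p) - b * (r * q))
      + 2 * (p * S) + b * (p * p)) := by
    rw [← key]; ring
  rw [hE]
  have : 1 / k * 30 = 30 / k := by ring
  rw [this] at hfin
  generalize 30 / k = z at *
  rw [abs_le] at *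
  constructor <;> linarith

/-- By the intermediate value theorem K·g covers an interval of length 4π, hence some 2πj and also
2πj + π. -/
theorem exists_cos_eq_one_and_neg_one {X : Type*} [TopologicalSpace X] {V : Set X} {g : X → ℝ}
    (hV : IsPreconnected V) (hg : ContinuousOn g V) {x y : X} (hx : x ∈ V) (hy : y ∈ V)
    {K : ℝ} (hK : 0 < K) (hK' : 4 * Real.pi ≤ K * (g y - g x)) :
    (∃ z ∈ V, Real.cos (K * g z) = 1) ∧ ∃ z ∈ V, Real.cos (K * g z) = -1 := by
  have hpi := Real.pi_pos
  have hI : ∀ t, K * g x ≤ t → t ≤ K * g y → ∃ z ∈ V, K * g z = t := by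
    intro t h1 h2
    obtain ⟨z, hz, hz'⟩ := hV.intermediate_value hx hy hg
      (show t / K ∈ Icc (g x) (g y) from
        ⟨(le_div_iff₀ hK).2 (by linarith), (div_le_iff₀ hK).2 (by linarith)⟩)
    exact ⟨z, hz, by rw [hz']; field_simp⟩
  have h1 := Int.le_ceil (K * g x / (2 * Real.pi))
  have h2 := Int.ceil_lt_add_one (K * g x / (2 * Real.pi))
  rw [div_le_iff₀ (by positivity)] at h1
  rw [← sub_lt_iff_lt_add, lt_div_iff₀ (by positivity)] at h2
  set j := ⌈K * g x / (2 * Real.pi)⌉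
  constructor
  · obtain ⟨z, hz, hz'⟩ := hI (j * (2 * Real.pi)) h1 (by linarith)
    exact ⟨z, hz, by rw [hz']; exact Real.cos_int_mul_two_pi j⟩
  · obtain ⟨z, hz, hz'⟩ := hI (j * (2 * Real.pi) + Real.pi) (by linarith) (by linarith)
    exact ⟨z, hz, by rw [hz']; exact Real.cos_int_mul_two_pi_add_pi j⟩

theorem IsSmoothCompactlySupported.exists_abs_le [Nonempty M] {F : M → ℝ}
    (hF : IsSmoothCompactlySupported n F) : ∃ C, ∀ x, |F x| ≤ C := by
  obtain ⟨a, ha⟩ := hF.exists_isGreatest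
  obtain ⟨b, hb⟩ := hF.exists_isLeast
  refine ⟨max a (-b), fun x => ?_⟩
  rw [abs_le']
  exact ⟨(ha.2 (mem_range_self x)).trans (le_max_left _ _),
    (neg_le_neg (hb.2 (mem_range_self x))).trans (le_max_right _ _)⟩

theorem IsSmoothCompactlySupported.oscillation {F g : M → ℝ}
    (hF : IsSmoothCompactlySupported n F) (hg : IsSmoothCompactlySupported n g) (k m : ℝ) :
    IsSmoothCompactlySupported n fun x => oscillation k m (g x) (F x) := by
  constructor
  · have h : ContDiff ℝ ∞ fun z : ℝ × ℝ => SymplecticFunctionTheory.oscillation k m z.1 z.2 := by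
      have h1 := contDiff_corrector
      have h2 := contDiff_oscSlope k
      unfold SymplecticFunctionTheory.oscillation
      fun_prop
    exact h.contMDiff.comp (hg.smooth.prodMk_space hF.smooth)
  -- The perturbation vanishes at v = 0, as `corrector` is zero there, so the support stays inside
  -- that of F.
  · refine hF.compactSupport.mono fun x hx h0 => hx ?_
    simp [SymplecticFunctionTheory.oscillation, h0, corrector]

theorem IsSmoothCompactlySupported.add_cos {g : M → ℝ}
    (hg : IsSmoothCompactlySupported n g) (k : ℝ) :
    IsSmoothCompactlySupported n fun x => g x + (1 - Real.cos (k ^ 2 * g x)) / k ^ 3 := by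
  constructor
  · have h : ContDiff ℝ ∞ fun u : ℝ => u + (1 - Real.cos (k ^ 2 * u)) / k ^ 3 := by
      fun_prop
    exact h.contMDiff.comp hg.smooth
  · refine hg.compactSupport.mono fun x hx h0 => hx ?_
    simp [h0]

/-! ### Estimates of the double brackets -/

namespace SymplecticForm

variable (Ω : SymplecticForm n M) [IsManifold (𝓡 (2 * n)) ∞ M]

/-- The case T(u,v) = v of `bracket_bracket_comp`. -/
theorem bracket_bracket_add_cos {F g : M → ℝ} (hF : IsSmoothCompactlySupported n F)
    (hg : IsSmoothCompactlySupported n g) {k : ℝ} (hk : k ≠ 0) (x : M) :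
    Ω.bracket (Ω.bracket F fun x => g x + (1 - Real.cos (k ^ 2 * g x)) / k ^ 3) F x =
      -(k * Real.cos (k ^ 2 * g x) * Ω.bracket g F x ^ 2
        + (1 + oscSlope k (g x)) * Ω.bracket (Ω.bracket g F) F x) := by
  have h := Ω.bracket_bracket_comp hF.smooth hg.smooth (hasDerivAt_sub_cos hk)
    (fun u => (hasDerivAt_oscSlope hk u).const_add 1)
    (T := fun _ v => v) (Tu := fun _ _ => 0) (Tv := fun _ _ => 1) (Tvu := fun _ _ => 0)
    (Tvv := fun _ _ => 0) (fun a b a' b' s _ hb => by simpa using hb)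
    (fun a b a' b' s _ _ => by simpa using hasDerivAt_const s (1 : ℝ))
    (hg.add_cos k).smooth hF.smooth x
  rw [h]
  ring

theorem abs_bracket_bracket_oscillation_le {F g : M → ℝ} (hF : IsSmoothCompactlySupported n F)
    (hg : IsSmoothCompactlySupported n g) {k m κ C : ℝ} (hk : 1 ≤ k) (hm : 0 < m)
    (hκ : ∀ x, Ω.bracket g F x ^ 2 ≤ κ) (hCF : ∀ x, |Ω.bracket (Ω.bracket g F) F x| ≤ C)
    (hCg : ∀ x, |Ω.bracket (Ω.bracket g F) g x| ≤ C) (x : M) :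
    |Ω.bracket (Ω.bracket (fun x => oscillation k m (g x) (F x))
        fun x => g x + (1 - Real.cos (k ^ 2 * g x)) / k ^ 3)
        (fun x => oscillation k m (g x) (F x)) x| ≤
      11 / 16 * κ * k + 30 * κ + 32 * C + 16 * k * C / m := by
  have hk0 : 0 < k := by linarith
  have h := Ω.bracket_bracket_comp hF.smooth hg.smooth (hasDerivAt_sub_cos hk0.ne')
    (fun u => (hasDerivAt_oscSlope hk0.ne' u).const_add 1)
    (T := oscillation k m)
    (Tu := fun u v => k * Real.cos (k ^ 2 * u) * corrector (m * v) / m)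
    (Tv := fun u v => 1 + Real.cos (m * v) / 2 + oscSlope k u *
      (-Real.cos (m * v) - Real.cos (2 * (m * v)) / 8))
    (Tvu := fun u v => k * Real.cos (k ^ 2 * u) *
      (-Real.cos (m * v) - Real.cos (2 * (m * v)) / 8))
    (Tvv := fun u v => m * (-Real.sin (m * v) / 2 + oscSlope k u *
      (Real.sin (m * v) + Real.sin (2 * (m * v)) / 4)))
    (hasDerivAt_oscillation hk0.ne' hm.ne') (hasDerivAt_oscillation_deriv hk0.ne' m)
    (hg.add_cos k).smooth (hF.oscillation hg k m).smooth x
  rw [h]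
  have hb := abs_oscSlope_le hk0 (g x)
  have hE := abs_reduction_factor_le hk hb (m * F x)
  have hb1 : |oscSlope k (g x)| ≤ 1 := hb.trans ((div_le_one hk0).2 hk)
  have hd := hκ x
  have hd0 := sq_nonneg (Ω.bracket g F x)
  have he := hCF x
  have he' := hCg x
  have hq := abs_corrector_le (m * F x)
  have hc := Real.abs_cos_le_one (m * F x)
  have hc2 := Real.abs_cos_le_one (2 * (m * F x))
  have hck := Real.abs_cos_le_one (k ^ 2 * g x)
  have hp : |-Real.cos (m * F x) - Real.cos (2 * (m * F x)) / 8| ≤ 2 := by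
    rw [abs_le] at *; constructor <;> linarith
  generalize oscSlope k (g x) = b at *
  generalize Ω.bracket g F x = d at *
  generalize Ω.bracket (Ω.bracket g F) F x = e at *
  generalize Ω.bracket (Ω.bracket g F) g x = e' at *
  generalize corrector (m * F x) = q at *
  generalize Real.cos (k ^ 2 * g x) = c at *
  generalize Real.sin (m * F x) = s at *
  generalize Real.sin (2 * (m * F x)) = s2 at *
  generalize -Real.cos (m * F x) - Real.cos (2 * (m * F x)) / 8 = p at *
  generalize Real.cos (m * F x) = c1 at *
  have mb : ∀ {x y X Y : ℝ}, |x| ≤ X → |y| ≤ Y → |x * y| ≤ X * Y := fun hx hy => by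
    rw [abs_mul]; exact mul_le_mul hx hy (abs_nonneg _) ((abs_nonneg _).trans hx)
  have hbp := mb hb1 hp
  have hS : |1 + c1 / 2 + b * p| ≤ 4 := by
    rw [abs_le] at *; constructor <;> linarith
  have hb2 : |1 + b| ≤ 2 := by
    rw [abs_le] at *; constructor <;> linarith
  generalize 1 + c1 / 2 + b * p = S at *
  have hdc : |d ^ 2 * c| ≤ κ * 1 := mb (by rwa [abs_of_nonneg hd0]) hck
  have hkk : |k| ≤ k := (abs_of_pos hk0).le
  have hmm : |m⁻¹| ≤ m⁻¹ := (abs_of_pos (inv_pos.2 hm)).le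
  -- `t1` bounds the leading term of order k, `t2` the term in T_u that dies as m grows, and `t3` a
  -- remainder bounded independently of k and m.
  have t1 := mb (mb hkk hdc) hE
  have t2 := mb (mb hS hb2) (mb (mb (mb (mb hkk hck) hq) hmm) he')
  have t3 := mb (mb hS hb2) (mb hS he)
  have r1 : k * (κ * 1) * (11 / 16 + 30 / k) = 11 / 16 * κ * k + 30 * κ := by
    field_simp
  have r2 : 4 * 2 * (k * 1 * 2 * m⁻¹ * C) = 16 * k * C / m := by
    field_simp; ring
  rw [r1] at t1
  rw [r2] at t2
  have hfin : ∀ a b c : ℝ, |-a - b - c| ≤ |a| + |b| + |c| := fun a b c => by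
    calc |-a - b - c| ≤ |-a - b| + |c| := abs_sub _ _
      _ ≤ |-a| + |b| + |c| := by gcongr; exact abs_sub _ _
      _ = _ := by rw [abs_neg]
  refine le_trans (le_of_eq ?_) ((hfin _ _ _).trans
    ((add_le_add (add_le_add t1 t2) t3).trans (by linarith)))
  congr 1
  field_simp
  ring

theorem exists_cos_eq_and_bracket_sq_ge {F g : M → ℝ} (hF : IsSmoothCompactlySupported n F)
    (hg : IsSmoothCompactlySupported n g) {p : M} {r : ℝ} (hp : Ω.bracket g F p ≠ 0)
    (hr : r < Ω.bracket g F p ^ 2) :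
    ∀ᶠ K : ℝ in atTop,
      (∃ z, r ≤ Ω.bracket g F z ^ 2 ∧ Real.cos (K * g z) = 1) ∧
      ∃ z, r ≤ Ω.bracket g F z ^ 2 ∧ Real.cos (K * g z) = -1 := by
  have : LocallyConnectedSpace M := ChartedSpace.locallyConnectedSpace (Model n) M
  have hcont : Continuous (Ω.bracket g F) := (hg.bracket Ω hF).smooth.continuous
  have hU : {x | r < Ω.bracket g F x ^ 2} ∈ 𝓝 p :=
    (isOpen_lt continuous_const (hcont.pow 2)).mem_nhds hr
  obtain ⟨V, ⟨hVo, hpV, hVc⟩, hVU⟩ :=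
    (LocallyConnectedSpace.open_connected_basis p).mem_iff.1 hU
  -- If g were constant on V, its bracket with F would vanish at p. So g sweeps out a fixed
  -- interval, which contains many periods for large K.
  obtain ⟨x, hx, y, hy, hxy⟩ : ∃ x ∈ V, ∃ y ∈ V, g x < g y := by
    by_contra! hcon
    refine hp (Ω.bracket_eq_zero_of_eventuallyEq_const (a := g p) F ?_)
    filter_upwards [hVo.mem_nhds hpV] with z hz
    exact le_antisymm (hcon _ hpV _ hz) (hcon _ hz _ hpV)
  filter_upwards [eventually_gt_atTop 0,
    eventually_ge_atTop (4 * Real.pi / (g y - g x))] with K hK hK'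
  rw [div_le_iff₀ (by linarith)] at hK'
  obtain ⟨⟨z, hz, hz'⟩, w, hw, hw'⟩ := exists_cos_eq_one_and_neg_one hVc.isPreconnected
    hg.smooth.continuous.continuousOn hx hy hK hK'
  exact ⟨⟨z, (hVU hz).le, hz'⟩, w, (hVU hw).le, hw'⟩

end SymplecticForm

/-- In `EReal` the limit inferior needs no lower bound on the sequence. -/
theorem liminf_coe_lt_of_eventually_le {u : ℕ → ℝ} {B A : ℝ} (hu : ∀ᶠ N in atTop, u N ≤ B)
    (hBA : B < A) : liminf (fun N : ℕ => ((u N : ℝ) : EReal)) atTop < ((A : ℝ) : EReal) := by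
  refine lt_of_le_of_lt (b := ((B : ℝ) : EReal)) ?_ (by exact_mod_cast hBA)
  refine liminf_le_of_frequently_le' (Eventually.frequently ?_)
  filter_upwards [hu] with N hN
  exact_mod_cast hN

end SymplecticFunctionTheory

end

/-! ### Choice of parameters and conclusion -/

open SymplecticFunctionTheory

theorem mainTheorem3 (n : ℕ) (hn : 1 ≤ n) (M : Type*) [TopologicalSpace M] [T2Space M] [Nonempty M]
    [ChartedSpace (SymplecticFunctionTheory.Model n) M] [IsManifold (𝓡 (2 * n)) ∞ M]
    (Ω : SymplecticFunctionTheory.SymplecticForm n M) :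
    ∃ (F G : M → ℝ) (FN : ℕ → M → ℝ),
      SymplecticFunctionTheory.IsSmoothCompactlySupported n F ∧
      SymplecticFunctionTheory.IsSmoothCompactlySupported n G ∧
      (∀ N : ℕ, SymplecticFunctionTheory.IsSmoothCompactlySupported n (FN N)) ∧
      TendstoUniformly FN F atTop ∧
      ∃ (mx mn : ℝ) (mxN mnN : ℕ → ℝ),
        IsGreatest (range (Ω.bracket (Ω.bracket F G) F)) mx ∧
        IsLeast (range (Ω.bracket (Ω.bracket F G) F)) mn ∧
        (∀ N : ℕ, IsGreatest (range (Ω.bracket (Ω.bracket (FN N) G) (FN N))) (mxN N)) ∧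
        (∀ N : ℕ, IsLeast (range (Ω.bracket (Ω.bracket (FN N) G) (FN N))) (mnN N)) ∧
        liminf (fun N : ℕ => ((mxN N : ℝ) : EReal)) atTop < ((0.99 * mx : ℝ) : EReal) ∧
        liminf (fun N : ℕ => ((-mnN N : ℝ) : EReal)) atTop < ((-(0.99 * mn) : ℝ) : EReal) := by
  obtain ⟨g, F, hg, hF, hne⟩ := Ω.exists_bracket_ne_zero hn (Classical.arbitrary M)
  have hd := hg.bracket Ω hF
  obtain ⟨C₁, hC₁⟩ := (hd.bracket Ω hF).exists_abs_le
  obtain ⟨C₂, hC₂⟩ := (hd.bracket Ω hg).exists_abs_le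
  obtain ⟨C, hCF, hCg⟩ : ∃ C, (∀ x, |Ω.bracket (Ω.bracket g F) F x| ≤ C) ∧
      ∀ x, |Ω.bracket (Ω.bracket g F) g x| ≤ C :=
    ⟨max C₁ C₂, fun x => (hC₁ x).trans (le_max_left _ _),
      fun x => (hC₂ x).trans (le_max_right _ _)⟩
  obtain ⟨p, hp⟩ : ∃ p, ∀ x, Ω.bracket g F x ^ 2 ≤ Ω.bracket g F p ^ 2 := by
    refine (hd.smooth.continuous.pow 2).exists_forall_ge_of_hasCompactSupport
      (hd.compactSupport.mono fun x hx h0 => hx ?_)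
    simp [h0]
  have hκ : 0 < Ω.bracket g F p ^ 2 := lt_of_lt_of_le (by positivity) (hp (Classical.arbitrary M))
  set κ := Ω.bracket g F p ^ 2 with hκdef
  have hC : 0 ≤ C := (abs_nonneg _).trans (hCF p)
  -- The frequency is K = k². The gap 0.99 · 9/10 - 11/16 exceeds 1/5, whence κ/5; 34C absorbs 32C
  -- and 0.99 · 2C.
  obtain ⟨k, ⟨⟨z, hz, hz'⟩, w, hw, hw'⟩, hk1, hk2⟩ :=
    (((tendsto_pow_atTop (α := ℝ) two_ne_zero).eventually
      (Ω.exists_cos_eq_and_bracket_sq_ge hF hg (r := 9 / 10 * κ) (p := p)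
      (fun h => hκ.ne' (by rw [hκdef, h]; norm_num)) (by linarith))).and
      ((eventually_ge_atTop (1 : ℝ)).and
        (eventually_gt_atTop ((30 * κ + 34 * C + 1) / (κ / 5))))).exists
  rw [div_lt_iff₀ (by positivity)] at hk2
  have hk0 : 0 < k := by linarith
  have hG := hg.add_cos k
  -- The frequency m is N + 1, hence positive also at N = 0.
  have hFN : ∀ N : ℕ, IsSmoothCompactlySupported n fun x => oscillation k (N + 1) (g x) (F x) :=
    fun N => hF.oscillation hg k _
  have hP := (hF.bracket Ω hG).bracket Ω hF
  have hPN := fun N => ((hFN N).bracket Ω hG).bracket Ω (hFN N)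
  obtain ⟨mx, hmx⟩ := hP.exists_isGreatest
  obtain ⟨mn, hmn⟩ := hP.exists_isLeast
  choose mxN hmxN using fun N => (hPN N).exists_isGreatest
  choose mnN hmnN using fun N => (hPN N).exists_isLeast
  have hbz : ∀ x, |(1 + oscSlope k (g x)) * Ω.bracket (Ω.bracket g F) F x| ≤ 2 * C := by
    intro x
    have h1 : |oscSlope k (g x)| ≤ 1 := (abs_oscSlope_le hk0 _).trans ((div_le_one hk0).2 hk1)
    rw [abs_mul]
    refine mul_le_mul ?_ (hCF x) (abs_nonneg _) zero_le_two
    rw [abs_le] at *; constructor <;> linarith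
  -- The double bracket carries a minus sign: the maximum is tested at `w`, where the cosine is -1,
  -- and the minimum at `z`, where it is 1.
  have hmx' : 9 / 10 * κ * k - 2 * C ≤ mx := by
    refine le_trans ?_ (hmx.2 (mem_range_self w))
    rw [Ω.bracket_bracket_add_cos hF hg hk0.ne', hw']
    have := (abs_le.1 (hbz w)).2
    have := mul_le_mul_of_nonneg_left hw hk0.le
    linarith
  have hmn' : 9 / 10 * κ * k - 2 * C ≤ -mn := by
    have h := hmn.2 (mem_range_self z)
    rw [Ω.bracket_bracket_add_cos hF hg hk0.ne', hz'] at h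
    have := (abs_le.1 (hbz z)).1
    have := mul_le_mul_of_nonneg_left hz hk0.le
    linarith
  have hm : Tendsto (fun N : ℕ => (N : ℝ) + 1) atTop atTop :=
    tendsto_atTop_add_const_right _ _ tendsto_natCast_atTop_atTop
  have hB : ∀ᶠ N : ℕ in atTop, ∀ x,
      |Ω.bracket (Ω.bracket (fun x => oscillation k (N + 1) (g x) (F x))
        fun x => g x + (1 - Real.cos (k ^ 2 * g x)) / k ^ 3)
        (fun x => oscillation k (N + 1) (g x) (F x)) x| ≤
      11 / 16 * κ * k + 30 * κ + 32 * C + 1 := by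
    filter_upwards [hm.eventually_ge_atTop (16 * k * C)] with N hN x
    refine (Ω.abs_bracket_bracket_oscillation_le hF hg hk1 (m := (N : ℝ) + 1) (by positivity)
      hp hCF hCg x).trans ?_
    gcongr
    exact (div_le_one (by positivity)).2 hN
  have hlt : 11 / 16 * κ * k + 30 * κ + 32 * C + 1 < 0.99 * (9 / 10 * κ * k - 2 * C) := by
    have := mul_pos hκ hk0
    linarith
  refine ⟨F, _, _, hF, hG, hFN, ?_, mx, mn, mxN, mnN, hmx, hmn, hmxN, hmnN, ?_, ?_⟩
  · rw [Metric.tendstoUniformly_iff]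
    intro ε hε
    filter_upwards [hm.eventually_gt_atTop (3 / ε)] with N hN x
    rw [dist_comm, Real.dist_eq]
    refine (abs_oscillation_sub_le hk1 (by positivity) _ _).trans_lt ?_
    rw [div_lt_iff₀ hε] at hN
    rw [div_lt_iff₀ (by positivity)]
    linarith
  · refine liminf_coe_lt_of_eventually_le (B := 11 / 16 * κ * k + 30 * κ + 32 * C + 1) ?_
      (by linarith)
    filter_upwards [hB] with N hN
    obtain ⟨x, hx⟩ := (hmxN N).1
    rw [← hx]
    exact (abs_le.1 (hN x)).2
  · refine liminf_coe_lt_of_eventually_le (B := 11 / 16 * κ * k + 30 * κ + 32 * C + 1) ?_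
      (by linarith)
    filter_upwards [hB] with N hN
    obtain ⟨x, hx⟩ := (hmnN N).1
    rw [← hx]
    exact neg_le.1 (abs_le.1 (hN x)).1
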